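/- Let $K\ge 1$. For a $K$-simplex $S\subset\mathbb R^K$ (the convex hull of $K+1$ affinely independent points) let $\mathrm{Vol}(S)$ be its Lebesgue measure, $A_{\max}(S)$ the $(K-1)$-dimensional volume of its largest facet, $L_{\max}(S)$ its diameter, and $\mathbb P_S$ the uniform probability measure on $S$. For $\sigma>0$ let $\mathbb G_S$ be the corresponding noisy simplex, i.e. the law of $x+z$ with $x\sim\mathbb P_S$ and $z\sim\mathcal N(0,\sigma^2 I)$ independent. For $\underline\theta,\bar\theta>0$, call $S$ $(\underline\theta,\bar\theta)$-isoperimetric if $A_{\max}(S)\le\bar\theta\,\mathrm{Vol}(S)^{(K-1)/K}$ and $L_{\max}(S)\le\underline\theta K\,\mathrm{Vol}(S)^{1/K}$. Write $\mathrm{TV}(P,Q)=\sup_B|P(B)-Q(B)|$, the supremum being over Borel sets $B$. **Theorem (agnostic PAC-learnability of simplices from noisy samples).** For all $\underline\theta,\bar\theta>0$ there is a constant $C>0$, depending only on $\underline\theta$ and $\bar\theta$, such that for every $K\ge1$ there is an algorithm (a measurable map which takes a finite sample in $\mathbb R^K$ of any size to a $K$-simplex in $\mathbb R^K$) with the following property.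 Let $\varepsilon_2,\delta>0$ and $$ n\ \ge\ C\left(\frac{K^2\log\!\left(1+\frac{K}{\varepsilon_2}\right)+\log\frac{12}{\delta}}{\varepsilon_2^2}+K^2\log\frac{12}{\delta}\right), $$ which is $\tilde O(K^2/\varepsilon_2^2)$. Then for every $(\underline\theta,\bar\theta)$-isoperimetric $K$-simplex $S$ and every $\sigma>0$, the output $\hat S$ of the algorithm on $n$ i.i.d. samples from $\mathbb G_S$ satisfies, with probability at least $1-\delta$, $$ \mathrm{TV}(\mathbb P_{\hat S},\mathbb P_S)\ \le\ 4\,\mathrm{TV}(\mathbb P_S,\mathbb G_S)+7\,\varepsilon_2 . $$ -/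

import Mathlib

open MeasureTheory ProbabilityTheory

noncomputable section

namespace SimplexLearning

/-- `ℝ^K` with the Euclidean norm. -/
abbrev E (K : ℕ) : Type := EuclideanSpace ℝ (Fin K)

/-- A `K`-simplex in `ℝ^K`, given by its `K + 1` affinely independent vertices. -/
abbrev KSimplex (K : ℕ) : Type := Affine.Simplex ℝ (E K) K

/-- The point set of a simplex: all convex combinations of its vertices. -/
def body {K : ℕ} (S : KSimplex K) : Set (E K) :=
  convexHull ℝ (Set.range S.points)

/-- The `i`-th facet: all convex combinations of the vertices other than the `i`-th. -/
def facet {K : ℕ} (S : KSimplex K) (i : Fin (K + 1)) : Set (E K) :=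
  convexHull ℝ (S.points '' {j | j ≠ i})

/-- `Vol(S)`, the Lebesgue measure of the simplex. -/
def vol {K : ℕ} (S : KSimplex K) : ℝ :=
  (volume : Measure (E K)).real (body S)

/-- The `(K-1)`-dimensional volume of the largest facet. Here `μHE[d]` is the Hausdorff measure
normalized so that it agrees with Lebesgue measure on `d`-dimensional Euclidean spaces. -/
def maxFacetVol {K : ℕ} (S : KSimplex K) : ℝ :=
  ⨆ i : Fin (K + 1), (μHE[K - 1] : Measure (E K)).real (facet S i)

/-- `(θlo, θhi)`-isoperimetricity. -/
def IsIsoperimetric {K : ℕ} (θlo θhi : ℝ) (S : KSimplex K) : Prop :=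
  maxFacetVol S ≤ θhi * vol S ^ (((K : ℝ) - 1) / (K : ℝ)) ∧
    Metric.diam (body S) ≤ θlo * (K : ℝ) * vol S ^ (1 / (K : ℝ))

/-- The uniform probability measure on a simplex. -/
def unif {K : ℕ} (S : KSimplex K) : Measure (E K) :=
  ProbabilityTheory.cond volume (body S)

/-- The noisy simplex: the law of `x + z` with `x` uniform on the simplex and `z` an independent
`N(0, σ² I)` vector. -/
def noisy {K : ℕ} (S : KSimplex K) (σ : ℝ) : Measure (E K) :=
  (unif S).conv (multivariateGaussian 0 (σ ^ 2 • (1 : Matrix (Fin K) (Fin K) ℝ)))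

/-- Total variation distance: the supremum of `|P(B) - Q(B)|` over all Borel sets `B`. -/
def tv {K : ℕ} (P Q : Measure (E K)) : ℝ :=
  ⨆ B : {B : Set (E K) // MeasurableSet B}, |P.real B.1 - Q.real B.1|

end SimplexLearning

end

/-! The learner is a minimum distance estimator in the style of Yatracos. A simplex law is uniform,
so the distance between two of them is attained on the difference of the two bodies
(`tv_unif_le_of_vol_le`). It therefore suffices to compare candidates with the sample on such
differences. The candidates form a countable family, dense in total variation
(`exists_tv_dense_seq`), which also makes the selection measurable.

A simplex is an intersection of `K + 1` half-spaces, so by Radon and Sauer-Shelah the differences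
have at most `(2n+1)^(2(K+1)^2)` traces on a double sample. Symmetrization turns this into uniform
convergence of empirical frequencies (`measure_exists_lt_abs_empirical_sub_le`). The triangle
inequality (`tv_minIndex_le`) then compares the selected simplex with `S`; noise enters only as the
distance from `unif S` to the sampling law. -/

noncomputable section

namespace SimplexLearning

variable {K : ℕ}

/-! ### Total variation distance -/

section TotalVariation

lemma tv_le {P Q : Measure (E K)} {c : ℝ}
    (h : ∀ B, MeasurableSet B → |P.real B - Q.real B| ≤ c) : tv P Q ≤ c :=
  have : Nonempty {B : Set (E K) // MeasurableSet B} := ⟨⟨∅, MeasurableSet.empty⟩⟩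
  ciSup_le fun B => h B.1 B.2

lemma tv_comm (P Q : Measure (E K)) : tv P Q = tv Q P := by
  simp only [tv, abs_sub_comm]

variable (P Q R : Measure (E K)) [IsProbabilityMeasure P] [IsProbabilityMeasure Q]
  [IsProbabilityMeasure R]

lemma abs_real_sub_real_le_one (B : Set (E K)) : |P.real B - Q.real B| ≤ 1 :=
  abs_sub_le_of_nonneg_of_le measureReal_nonneg measureReal_le_one measureReal_nonneg
    measureReal_le_one

lemma abs_real_sub_real_le_tv {B : Set (E K)} (hB : MeasurableSet B) :
    |P.real B - Q.real B| ≤ tv P Q :=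
  le_ciSup (f := fun B : {B : Set (E K) // MeasurableSet B} => |P.real B.1 - Q.real B.1|)
    ⟨1, by rintro _ ⟨B, rfl⟩; exact abs_real_sub_real_le_one P Q B.1⟩ ⟨B, hB⟩

lemma tv_le_one : tv P Q ≤ 1 := tv_le fun B _ => abs_real_sub_real_le_one P Q B

lemma tv_nonneg : 0 ≤ tv P Q :=
  (abs_nonneg _).trans (abs_real_sub_real_le_tv P Q MeasurableSet.empty)

lemma tv_triangle : tv P R ≤ tv P Q + tv Q R :=
  tv_le fun B hB => (abs_sub_le _ (Q.real B) _).trans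
    (add_le_add (abs_real_sub_real_le_tv P Q hB) (abs_real_sub_real_le_tv Q R hB))

end TotalVariation

/-! ### Simplices and their uniform laws -/

/-- The vertices of a full-dimensional simplex as an affine basis. -/
def vertexBasis (S : KSimplex K) : AffineBasis (Fin (K + 1)) ℝ (E K) where
  toFun := S.points
  ind' := S.independent
  tot' := by
    rw [S.independent.affineSpan_eq_top_iff_card_eq_finrank_add_one]
    simp

lemma body_eq_iInter (S : KSimplex K) :
    body S = ⋂ i, {x | 0 ≤ (vertexBasis S).coord i x} := by
  have h := (vertexBasis S).convexHull_eq_nonneg_coord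
  ext x
  rw [Set.mem_iInter]
  change x ∈ convexHull ℝ (Set.range (vertexBasis S)) ↔ _
  rw [h]
  rfl

lemma isCompact_body (S : KSimplex K) : IsCompact (body S) :=
  (Set.finite_range _).isCompact_convexHull ℝ

lemma measurableSet_body (S : KSimplex K) : MeasurableSet (body S) :=
  (isCompact_body S).isClosed.measurableSet

lemma volume_body_ne_top (S : KSimplex K) : (volume : Measure (E K)) (body S) ≠ ⊤ :=
  (isCompact_body S).measure_lt_top.ne

lemma volume_body_ne_zero (S : KSimplex K) : (volume : Measure (E K)) (body S) ≠ 0 := by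
  exact (Measure.measure_pos_of_nonempty_interior _
    ⟨_, (vertexBasis S).centroid_mem_interior_convexHull⟩).ne'

lemma vol_pos (S : KSimplex K) : 0 < vol S :=
  ENNReal.toReal_pos (volume_body_ne_zero S) (volume_body_ne_top S)

instance isProbabilityMeasure_unif (S : KSimplex K) : IsProbabilityMeasure (unif S) :=
  cond_isProbabilityMeasure_of_finite (volume_body_ne_zero S) (volume_body_ne_top S)

instance isProbabilityMeasure_noisy (S : KSimplex K) (σ : ℝ) :
    IsProbabilityMeasure (noisy S σ) := by
  unfold noisy
  infer_instance

lemma unif_real (S : KSimplex K) (B : Set (E K)) :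
    (unif S).real B = (vol S)⁻¹ * (volume : Measure (E K)).real (body S ∩ B) := by
  rw [unif, measureReal_def, cond_apply (measurableSet_body S), ENNReal.toReal_mul,
    ENNReal.toReal_inv]
  rfl

lemma nonempty_kSimplex (K : ℕ) : Nonempty (KSimplex K) := by
  obtain ⟨b⟩ := AffineBasis.exists_affineBasis_of_finiteDimensional (k := ℝ) (P := E K)
    (ι := Fin (K + 1)) (by simp)
  exact ⟨⟨b, b.ind⟩⟩

/-- On the common part of the bodies, the larger simplex has the smaller density. -/
lemma unif_real_le_of_vol_le {S S' : KSimplex K} (h : vol S' ≤ vol S) (B : Set (E K)) :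
    (unif S).real B ≤ (unif S).real (body S \ body S') + (unif S').real B := by
  have h1 : (unif S).real B ≤ (unif S).real (body S \ body S') + (unif S).real (body S' ∩ B) := by
    rw [unif_real, unif_real, unif_real, ← mul_add]
    refine mul_le_mul_of_nonneg_left ?_ (inv_nonneg.2 (vol_pos S).le)
    refine (measureReal_mono ?_ ?_).trans (measureReal_union_le _ _)
    · intro x hx
      by_cases hx' : x ∈ body S'
      · exact Or.inr ⟨hx.1, hx', hx.2⟩
      · exact Or.inl ⟨hx.1, hx.1, hx'⟩
    · exact ((measure_mono (Set.union_subset Set.inter_subset_left Set.inter_subset_left)).trans_lt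
        (volume_body_ne_top S).lt_top).ne
  refine h1.trans (add_le_add le_rfl ?_)
  rw [unif_real, unif_real]
  refine mul_le_mul (inv_anti₀ (vol_pos S') h) ?_ measureReal_nonneg (inv_nonneg.2 (vol_pos S').le)
  exact measureReal_mono Set.inter_subset_right
    (measure_ne_top_of_subset Set.inter_subset_left (volume_body_ne_top S'))

/-- The total variation distance of two uniform laws is attained at the difference set of the
simplices. -/
lemma tv_unif_le_of_vol_le {S S' : KSimplex K} (h : vol S' ≤ vol S) :
    tv (unif S) (unif S') ≤
      |(unif S).real (body S \ body S') - (unif S').real (body S \ body S')| := by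
  have h0 : (unif S').real (body S \ body S') = 0 := by
    rw [unif_real]
    have : body S' ∩ (body S \ body S') = ∅ := by ext; simp +contextual
    simp [this]
  rw [h0, sub_zero, abs_of_nonneg measureReal_nonneg]
  refine tv_le fun B hB => abs_sub_le_iff.2 ⟨?_, ?_⟩
  · linarith [unif_real_le_of_vol_le h B]
  -- Passing to the complement reverses the inequality.
  · have := unif_real_le_of_vol_le h Bᶜ
    rw [probReal_compl_eq_one_sub hB, probReal_compl_eq_one_sub hB] at this
    linarith

/-! ### A countable dense family of simplices -/

/-- The density of the uniform law on a simplex. -/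
def density (S : KSimplex K) : Lp ℝ 1 (volume : Measure (E K)) :=
  indicatorConstLp 1 (measurableSet_body S) (volume_body_ne_top S) (vol S)⁻¹

lemma unif_real_eq_setIntegral (S : KSimplex K) {B : Set (E K)} (hB : MeasurableSet B) :
    (unif S).real B = ∫ x in B, density S x := by
  rw [density, setIntegral_indicatorConstLp hB, unif_real, smul_eq_mul, mul_comm]

lemma tv_unif_le_dist (S S' : KSimplex K) :
    tv (unif S) (unif S') ≤ dist (density S) (density S') := by
  refine tv_le fun B hB => ?_
  rw [unif_real_eq_setIntegral S hB, unif_real_eq_setIntegral S' hB, ← integral_sub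
    (L1.integrable_coeFn _).integrableOn (L1.integrable_coeFn _).integrableOn, dist_eq_norm,
    L1.norm_eq_integral_norm, ← Real.norm_eq_abs]
  refine (norm_integral_le_integral_norm _).trans ?_
  have h : ∀ᵐ x, ‖(density S - density S') x‖ = ‖density S x - density S' x‖ := by
    filter_upwards [Lp.coeFn_sub (density S) (density S')] with x hx
    rw [hx, Pi.sub_apply]
  rw [integral_congr_ae h]
  refine setIntegral_le_integral ?_ (Filter.Eventually.of_forall fun x => norm_nonneg _)
  exact ((L1.integrable_coeFn _).sub (L1.integrable_coeFn _)).norm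

/-- `L¹` is separable, hence so is its subset of simplex densities, and the `L¹` distance dominates
`tv`. -/
lemma exists_tv_dense_seq (K : ℕ) :
    ∃ T : ℕ → KSimplex K, ∀ S : KSimplex K, ∀ η > 0, ∃ j, tv (unif (T j)) (unif S) ≤ η := by
  have := nonempty_kSimplex K
  have : Fact ((1 : ENNReal) ≠ ⊤) := ⟨ENNReal.one_ne_top⟩
  have : Nonempty (Set.range (density (K := K))) := (Set.range_nonempty _).to_subtype
  choose T hT using fun j => (TopologicalSpace.denseSeq (Set.range (density (K := K))) j).2
  refine ⟨T, fun S η hη => ?_⟩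
  obtain ⟨j, hj⟩ := (TopologicalSpace.denseRange_denseSeq
    (Set.range (density (K := K)))).exists_dist_lt ⟨density S, S, rfl⟩ hη
  refine ⟨j, (tv_unif_le_dist _ _).trans ?_⟩
  rw [hT, dist_comm]
  exact hj.le

/-! ### Counting traces -/

lemma sum_choose_le_succ_pow (m d : ℕ) :
    ∑ k ∈ Finset.Iic d, m.choose k ≤ (m + 1) ^ d := by
  have h : Finset.Iic d = Finset.range (d + 1) := by ext; simp
  rw [h]
  clear h
  induction d with
  | zero => simp
  | succ d ih =>
    rw [Finset.sum_range_succ, pow_succ, mul_add, mul_one, add_comm]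
    refine add_le_add ((Nat.choose_le_pow m (d + 1)).trans ?_) ih
    rw [pow_succ]
    exact Nat.mul_le_mul_right _ (Nat.pow_le_pow_left (Nat.le_succ m) d)

/-- The traces of a family of sets on a finite family of points. -/
def traces {α I : Type*} (x : I → α) (𝒞 : Set (Set α)) : Set (Set I) :=
  (fun B => x ⁻¹' B) '' 𝒞

section Traces

variable {α I : Type*} [Finite I] (x : I → α)

/-- The **Sauer-Shelah lemma** for traces. -/
lemma ncard_traces_le_of_shatters (𝒞 : Set (Set α)) (d : ℕ)
    (h : ∀ s : Finset I, (∀ t ⊆ s, ∃ B ∈ 𝒞, ∀ i ∈ s, x i ∈ B ↔ i ∈ t) → s.card ≤ d) :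
    (traces x 𝒞).ncard ≤ (Nat.card I + 1) ^ d := by
  classical
  have := Fintype.ofFinite I
  let 𝒜 : Finset (Finset I) := (traces x 𝒞).toFinite.toFinset.image fun A => A.toFinset
  have hcard : (traces x 𝒞).ncard = 𝒜.card := by
    rw [Finset.card_image_of_injective, Set.ncard_eq_toFinset_card _ (Set.toFinite _)]
    intro A B hAB
    simpa using hAB
  have hvc : 𝒜.vcDim ≤ d := by
    refine Finset.sup_le fun s hs => h s fun t ht => ?_
    obtain ⟨u, hu, hut⟩ := (Finset.mem_shatterer.1 hs) ht
    obtain ⟨A, hA, rfl⟩ := Finset.mem_image.1 hu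
    obtain ⟨B, hB, rfl⟩ := (Set.Finite.mem_toFinset _).1 hA
    refine ⟨B, hB, fun i hi => ?_⟩
    rw [← hut]
    simp [hi]
  rw [hcard, Nat.card_eq_fintype_card]
  refine 𝒜.card_le_card_shatterer.trans (Finset.card_shatterer_le_sum_vcDim.trans ?_)
  exact (sum_choose_le_succ_pow _ _).trans (Nat.pow_le_pow_right (Nat.succ_pos _) hvc)

lemma ncard_traces_image2_sdiff_le (𝒞 : Set (Set α)) :
    (traces x (Set.image2 (· \ ·) 𝒞 𝒞)).ncard ≤ (traces x 𝒞).ncard ^ 2 := by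
  have h : traces x (Set.image2 (· \ ·) 𝒞 𝒞) ⊆
      (fun p : Set I × Set I => p.1 \ p.2) '' (traces x 𝒞 ×ˢ traces x 𝒞) := by
    rintro _ ⟨_, ⟨A, hA, B, hB, rfl⟩, rfl⟩
    exact ⟨(x ⁻¹' A, x ⁻¹' B), ⟨⟨A, hA, rfl⟩, ⟨B, hB, rfl⟩⟩, rfl⟩
  refine (Set.ncard_le_ncard h).trans ((Set.ncard_image_le (Set.toFinite _)).trans ?_)
  rw [Set.ncard_prod, sq]

lemma ncard_traces_iInter_le {ι : Type*} [Fintype ι] (𝒞 : Set (Set α)) :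
    (traces x {A | ∃ B : ι → Set α, (∀ i, B i ∈ 𝒞) ∧ A = ⋂ i, B i}).ncard ≤
      (traces x 𝒞).ncard ^ Fintype.card ι := by
  classical
  have h : traces x {A | ∃ B : ι → Set α, (∀ i, B i ∈ 𝒞) ∧ A = ⋂ i, B i} ⊆
      (fun t : ι → Set I => ⋂ i, t i) ''
        (Fintype.piFinset fun _ : ι => (traces x 𝒞).toFinite.toFinset : Finset (ι → Set I)) := by
    rintro _ ⟨_, ⟨B, hB, rfl⟩, rfl⟩
    refine ⟨fun i => x ⁻¹' B i, ?_, Set.preimage_iInter.symm⟩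
    simp only [Finset.mem_coe, Fintype.mem_piFinset, Set.Finite.mem_toFinset]
    exact fun i => ⟨B i, hB i, rfl⟩
  refine (Set.ncard_le_ncard h).trans ((Set.ncard_image_le (Set.toFinite _)).trans ?_)
  rw [Set.ncard_coe_finset, Fintype.card_piFinset, Finset.prod_const,
    Set.ncard_eq_toFinset_card _ (Set.toFinite _), Finset.card_univ]

end Traces

/-- **Radon's theorem** bounds the number of traces of half-spaces. -/
lemma ncard_traces_halfspace_le {V I : Type*} [AddCommGroup V] [Module ℝ V]
    [FiniteDimensional ℝ V] [Finite I] (x : I → V) :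
    (traces x {B : Set V | Convex ℝ B ∧ Convex ℝ Bᶜ}).ncard ≤
      (Nat.card I + 1) ^ (Module.finrank ℝ V + 1) := by
  refine ncard_traces_le_of_shatters x _ _ fun s hs => ?_
  by_contra hcard
  obtain ⟨u, hus, hu⟩ := Finset.exists_subset_card_eq
    (show Module.finrank ℝ V + 2 ≤ s.card by omega)
  have hdep : ¬ AffineIndependent ℝ (fun i : u => x i) := by
    rw [← finrank_vectorSpan_le_iff_not_affineIndependent ℝ _ (n := Module.finrank ℝ V)
      (by simpa using hu)]
    exact Submodule.finrank_le _
  obtain ⟨J, p, hpJ, hpJc⟩ := Convex.radon_partition hdep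
  classical
  obtain ⟨B, ⟨hB, hBc⟩, h⟩ := hs (s.filter fun i => ∃ hi : i ∈ u, (⟨i, hi⟩ : u) ∈ J)
    (Finset.filter_subset _ _)
  -- The Radon point `p` would lie both in `B`, which picks out `J`, and in its convex complement.
  refine convexHull_min ?_ hBc hpJc (convexHull_min ?_ hB hpJ)
  · rintro _ ⟨i, hi, rfl⟩
    rw [Set.mem_compl_iff, h _ (hus i.2)]
    simp only [Finset.mem_filter, not_and, not_exists]
    exact fun _ _ => hi
  · rintro _ ⟨i, hi, rfl⟩
    rw [h _ (hus i.2)]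
    exact Finset.mem_filter.2 ⟨hus i.2, i.2, hi⟩

/-! ### Symmetrization and exponential moments -/

/-- The sum over signs factors into `∏ 2 cosh (t * a i)`, and `cosh x ≤ exp (x ^ 2 / 2)`. -/
lemma sum_bool_exp_le {n : ℕ} (a : Fin n → ℝ) (ha : ∀ i, |a i| ≤ 1) (t : ℝ) :
    ∑ s : Fin n → Bool, Real.exp (t * ∑ i, (if s i then a i else -a i)) ≤
      2 ^ n * Real.exp (n * t ^ 2 / 2) := by
  have h1 : ∀ s : Fin n → Bool, Real.exp (t * ∑ i, (if s i then a i else -a i)) =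
      ∏ i, (if s i then Real.exp (t * a i) else Real.exp (-(t * a i))) := by
    intro s
    rw [Finset.mul_sum, Real.exp_sum]
    refine Finset.prod_congr rfl fun i _ => ?_
    split <;> simp
  simp_rw [h1]
  have h2 := Finset.prod_univ_sum (fun _ : Fin n => (Finset.univ : Finset Bool))
    (fun i b => if b then Real.exp (t * a i) else Real.exp (-(t * a i)))
  rw [Fintype.piFinset_univ] at h2
  rw [← h2]
  have h3 : ∀ i, ∑ b : Bool, (if b then Real.exp (t * a i) else Real.exp (-(t * a i))) ≤
      2 * Real.exp (t ^ 2 / 2) := by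
    intro i
    have h4 := Real.cosh_le_exp_half_sq (t * a i)
    rw [Real.cosh_eq] at h4
    have h5 : (t * a i) ^ 2 ≤ t ^ 2 := by
      rw [mul_pow]
      have : a i ^ 2 ≤ 1 := by
        rw [← sq_abs]; exact pow_le_one₀ (abs_nonneg _) (ha i)
      nlinarith [sq_nonneg t]
    have h6 : Real.exp ((t * a i) ^ 2 / 2) ≤ Real.exp (t ^ 2 / 2) :=
      Real.exp_le_exp.2 (by linarith)
    simp only [Fintype.sum_bool, if_true, Bool.false_eq_true, if_false]
    linarith
  refine (Finset.prod_le_prod (fun i _ => Finset.sum_nonneg fun b _ => ?_) fun i _ => h3 i).trans ?_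
  · split <;> positivity
  · rw [Finset.prod_const, mul_pow, ← Real.exp_nat_mul, Finset.card_univ, Fintype.card_fin]
    refine le_of_eq ?_
    congr 2
    ring

section Symmetrization

variable {Ω ι : Type*} {n : ℕ}

/-- The exponential moment of a symmetrized sum, as a supremum over a family of functions. -/
def expSup (f : ι → Ω → ℝ) (t : ℝ) (z : (Fin n → Ω) × (Fin n → Ω)) : ENNReal :=
  ⨆ j, ENNReal.ofReal (Real.exp (t * ∑ i, (f j (z.1 i) - f j (z.2 i))))

/-- Exchange the two samples at the indices where `s` is false. -/
def swapAt (s : Fin n → Bool) (z : (Fin n → Ω) × (Fin n → Ω)) : (Fin n → Ω) × (Fin n → Ω) :=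
  (fun i => if s i then z.1 i else z.2 i, fun i => if s i then z.2 i else z.1 i)

/-- Seen as `n` independent pairs, the double sample is invariant under swapping within any pair. -/
lemma measurePreserving_swapAt [MeasurableSpace Ω] (μ : Measure Ω) [IsProbabilityMeasure μ]
    (s : Fin n → Bool) :
    MeasurePreserving (swapAt s)
      ((Measure.pi fun _ : Fin n => μ).prod (Measure.pi fun _ : Fin n => μ))
      ((Measure.pi fun _ : Fin n => μ).prod (Measure.pi fun _ : Fin n => μ)) := by
  have h := measurePreserving_arrowProdEquivProdArrow Ω Ω (Fin n) (fun _ => μ) (fun _ => μ)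
  have hs : MeasurePreserving
      (fun (w : Fin n → Ω × Ω) i => (if s i then id else Prod.swap : Ω × Ω → Ω × Ω) (w i))
      (Measure.pi fun _ : Fin n => μ.prod μ) (Measure.pi fun _ : Fin n => μ.prod μ) := by
    refine measurePreserving_pi _ _ fun i => ?_
    cases s i
    · simpa using Measure.measurePreserving_swap
    · simpa using MeasurePreserving.id _
  have := (h.comp hs).comp (h.symm _)
  convert this using 1
  funext z
  refine Prod.ext (funext fun i => ?_) (funext fun i => ?_) <;>
  · simp only [swapAt, Function.comp, MeasurableEquiv.arrowProdEquivProdArrow,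
      Equiv.arrowProdEquivProdArrow, MeasurableEquiv.symm, MeasurableEquiv.coe_mk, Equiv.symm,
      Equiv.coe_fn_mk]
    split <;> rfl

/-- A swap flips the sign of one difference. The supremum is at most the sum over the distinct
difference vectors, each bounded by `sum_bool_exp_le`. -/
lemma sum_expSup_swapAt_le (f : ι → Ω → ℝ) (hf : ∀ j x y, |f j x - f j y| ≤ 1) (t : ℝ) {N : ℕ}
    (z : (Fin n → Ω) × (Fin n → Ω))
    (hfin : (Set.range fun j (i : Fin n) => f j (z.1 i) - f j (z.2 i)).Finite)
    (hN : (Set.range fun j (i : Fin n) => f j (z.1 i) - f j (z.2 i)).ncard ≤ N) :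
    ∑ s : Fin n → Bool, expSup f t (swapAt s z) ≤
      N * (2 ^ n * ENNReal.ofReal (Real.exp (n * t ^ 2 / 2))) := by
  set V := Set.range fun j (i : Fin n) => f j (z.1 i) - f j (z.2 i)
  have h1 : ∀ s : Fin n → Bool, expSup f t (swapAt s z) ≤ ∑ a ∈ hfin.toFinset,
      ENNReal.ofReal (Real.exp (t * ∑ i, (if s i then a i else -a i))) := by
    intro s
    refine iSup_le fun j => ?_
    have hj : (fun i : Fin n => f j (z.1 i) - f j (z.2 i)) ∈ hfin.toFinset :=
      hfin.mem_toFinset.2 ⟨j, rfl⟩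
    refine le_trans (le_of_eq ?_) (Finset.single_le_sum (f := fun a : Fin n → ℝ =>
      ENNReal.ofReal (Real.exp (t * ∑ i, (if s i then a i else -a i))))
      (fun _ _ => zero_le) hj)
    congr 3
    refine Finset.sum_congr rfl fun i _ => ?_
    simp only [swapAt]
    split <;> simp
  refine (Finset.sum_le_sum fun s _ => h1 s).trans ?_
  rw [Finset.sum_comm]
  have h2 : ∀ a ∈ hfin.toFinset, ∑ s : Fin n → Bool,
      ENNReal.ofReal (Real.exp (t * ∑ i, (if s i then a i else -a i))) ≤
      2 ^ n * ENNReal.ofReal (Real.exp (n * t ^ 2 / 2)) := by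
    intro a ha
    obtain ⟨j, rfl⟩ := hfin.mem_toFinset.1 ha
    rw [← ENNReal.ofReal_sum_of_nonneg fun _ _ => (Real.exp_pos _).le]
    refine (ENNReal.ofReal_le_ofReal (sum_bool_exp_le _ (fun i => hf j _ _) t)).trans ?_
    rw [ENNReal.ofReal_mul (by positivity), ENNReal.ofReal_pow (by norm_num),
      ENNReal.ofReal_ofNat]
  refine (Finset.sum_le_card_nsmul _ _ _ h2).trans ?_
  rw [nsmul_eq_mul, ← Set.ncard_eq_toFinset_card _ hfin]
  gcongr

variable [MeasurableSpace Ω] (μ : Measure Ω) [IsProbabilityMeasure μ]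

lemma measurable_expSup [Countable ι] {f : ι → Ω → ℝ} (hm : ∀ j, Measurable (f j)) (t : ℝ) :
    Measurable (expSup (n := n) f t) := by
  refine Measurable.iSup fun j => ?_
  have := hm j
  fun_prop

lemma lintegral_expSup_le [Countable ι] {f : ι → Ω → ℝ} (hm : ∀ j, Measurable (f j))
    (hf : ∀ j x y, |f j x - f j y| ≤ 1) (t : ℝ) {N : ℕ}
    (hfin : ∀ y y' : Fin n → Ω, (Set.range fun j i => f j (y i) - f j (y' i)).Finite)
    (hN : ∀ y y' : Fin n → Ω, (Set.range fun j i => f j (y i) - f j (y' i)).ncard ≤ N) :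
    ∫⁻ z, expSup f t z ∂((Measure.pi fun _ : Fin n => μ).prod (Measure.pi fun _ : Fin n => μ)) ≤
      N * ENNReal.ofReal (Real.exp (n * t ^ 2 / 2)) := by
  set M := (Measure.pi fun _ : Fin n => μ).prod (Measure.pi fun _ : Fin n => μ)
  have h1 : ∀ s : Fin n → Bool, ∫⁻ z, expSup f t (swapAt s z) ∂M = ∫⁻ z, expSup f t z ∂M :=
    fun s => (measurePreserving_swapAt μ s).lintegral_comp (measurable_expSup hm t)
  -- Averaging over all swaps leaves the integral unchanged.
  have h2 : (2 : ENNReal) ^ n * ∫⁻ z, expSup f t z ∂M =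
      ∫⁻ z, ∑ s : Fin n → Bool, expSup f t (swapAt s z) ∂M := by
    rw [lintegral_finsetSum]
    · simp [h1]
    · exact fun s _ => (measurable_expSup hm t).comp (measurePreserving_swapAt μ s).measurable
  have h3 : (2 : ENNReal) ^ n * ∫⁻ z, expSup f t z ∂M ≤
      2 ^ n * (N * ENNReal.ofReal (Real.exp (n * t ^ 2 / 2))) := by
    rw [h2]
    refine (lintegral_mono fun z =>
      sum_expSup_swapAt_le f hf t z (hfin z.1 z.2) (hN z.1 z.2)).trans ?_
    rw [lintegral_const, measure_univ, mul_one, mul_left_comm]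
  exact (ENNReal.mul_le_mul_iff_right (by simp) (by finiteness)).1 h3

/-- Jensen's inequality in the ghost sample `y'`, whose mean replaces the expectation. -/
lemma exp_le_lintegral_exp {f : Ω → ℝ} (hm : Measurable f) (hb : ∀ x, |f x| ≤ 1) (t : ℝ)
    (y : Fin n → Ω) :
    ENNReal.ofReal (Real.exp (t * ∑ i, (f (y i) - ∫ x, f x ∂μ))) ≤
      ∫⁻ y' : Fin n → Ω, ENNReal.ofReal (Real.exp (t * ∑ i, (f (y i) - f (y' i))))
        ∂(Measure.pi fun _ : Fin n => μ) := by
  set M := Measure.pi fun _ : Fin n => μ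
  have hint : ∀ i : Fin n, Integrable (fun y' : Fin n → Ω => f (y' i)) M := fun i =>
    Integrable.of_bound (hm.comp (measurable_pi_apply i)).aestronglyMeasurable 1 (Filter.Eventually.of_forall fun y' => hb _)
  have hg : Integrable (fun y' : Fin n → Ω => t * ∑ i, (f (y i) - f (y' i))) M :=
    (integrable_finsetSum _ fun i _ => (integrable_const _).sub (hint i)).const_mul t
  have hbound : ∀ y' : Fin n → Ω, t * ∑ i, (f (y i) - f (y' i)) ≤ |t| * (n * 2) := by
    intro y'
    refine (le_abs_self _).trans ?_
    rw [abs_mul]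
    refine mul_le_mul_of_nonneg_left ((Finset.abs_sum_le_sum_abs _ _).trans ?_) (abs_nonneg t)
    refine (Finset.sum_le_card_nsmul _ _ 2 fun i _ => ?_).trans (by simp)
    refine (abs_sub _ _).trans ?_
    linarith [hb (y i), hb (y' i)]
  have hexp : Integrable (fun y' : Fin n → Ω => Real.exp (t * ∑ i, (f (y i) - f (y' i)))) M := by
    have : Measurable fun y' : Fin n → Ω => Real.exp (t * ∑ i, (f (y i) - f (y' i))) := by
      fun_prop
    refine Integrable.of_bound this.aestronglyMeasurable (Real.exp (|t| * (n * 2)))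
      (Filter.Eventually.of_forall fun y' => ?_)
    rw [Real.norm_eq_abs, abs_of_pos (Real.exp_pos _)]
    exact Real.exp_le_exp.2 (hbound y')
  rw [← ofReal_integral_eq_lintegral_ofReal hexp
    (Filter.Eventually.of_forall fun y' => (Real.exp_pos _).le)]
  refine ENNReal.ofReal_le_ofReal ?_
  have hJ := convexOn_exp.map_integral_le Real.continuous_exp.continuousOn isClosed_univ
    (Filter.Eventually.of_forall fun _ => Set.mem_univ _) hg hexp
  refine le_trans (le_of_eq ?_) hJ
  rw [integral_const_mul, integral_finsetSum]
  swap
  · exact fun i _ => (integrable_const _).sub (hint i)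
  congr 2
  refine Finset.sum_congr rfl fun i _ => ?_
  rw [integral_sub (integrable_const _) (hint i), integral_const, probReal_univ, one_smul,
    integral_comp_eval hm.aestronglyMeasurable]

/-- One-sided uniform deviation inequality for a countable family of functions with finitely many
traces on every double sample. -/
lemma measure_exists_sum_ge_le [Countable ι] {f : ι → Ω → ℝ} (hm : ∀ j, Measurable (f j))
    (hb : ∀ j x, |f j x| ≤ 1) (hf : ∀ j x y, |f j x - f j y| ≤ 1) {t : ℝ} (ht : 0 ≤ t) {N : ℕ}
    (hfin : ∀ y y' : Fin n → Ω, (Set.range fun j i => f j (y i) - f j (y' i)).Finite)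
    (hN : ∀ y y' : Fin n → Ω, (Set.range fun j i => f j (y i) - f j (y' i)).ncard ≤ N) :
    (Measure.pi fun _ : Fin n => μ) {y | ∃ j, n * t ≤ ∑ i, (f j (y i) - ∫ x, f j x ∂μ)} ≤
      ENNReal.ofReal (N * Real.exp (-(n * t ^ 2 / 2))) := by
  set M := Measure.pi fun _ : Fin n => μ
  have hexp : ∫⁻ y, ∫⁻ y', expSup f t (y, y') ∂M ∂M ≤
      N * ENNReal.ofReal (Real.exp (n * t ^ 2 / 2)) := by
    rw [← lintegral_prod _ (measurable_expSup hm t).aemeasurable]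
    exact lintegral_expSup_le μ hm hf t hfin hN
  -- Markov's inequality at level `exp (n * t ^ 2)`: the deviation `t` also serves as exponential
  -- parameter, which leaves `exp (-(n * t ^ 2 / 2))`.
  have hsub : {y : Fin n → Ω | ∃ j, n * t ≤ ∑ i, (f j (y i) - ∫ x, f j x ∂μ)} ⊆
      {y | ENNReal.ofReal (Real.exp (n * t ^ 2)) ≤ ∫⁻ y', expSup f t (y, y') ∂M} := by
    rintro y ⟨j, hj⟩
    refine (ENNReal.ofReal_le_ofReal (Real.exp_le_exp.2 ?_)).trans
      ((exp_le_lintegral_exp μ (hm j) (hb j) t y).trans (lintegral_mono fun y' => ?_))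
    · calc n * t ^ 2 = t * (n * t) := by ring
        _ ≤ _ := mul_le_mul_of_nonneg_left hj ht
    · exact le_iSup (fun j => ENNReal.ofReal (Real.exp (t * ∑ i, (f j (y i) - f j (y' i))))) j
  refine (measure_mono hsub).trans ?_
  have hpos : ENNReal.ofReal (Real.exp (n * t ^ 2)) ≠ 0 := by
    simpa using Real.exp_pos _
  refine (meas_ge_le_lintegral_div
    (measurable_expSup hm t).lintegral_prod_right'.aemeasurable hpos ENNReal.ofReal_ne_top).trans ?_
  refine (ENNReal.div_le_div_right hexp _).trans (le_of_eq ?_)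
  rw [← ENNReal.ofReal_natCast N, ← ENNReal.ofReal_mul (Nat.cast_nonneg _),
    ← ENNReal.ofReal_div_of_pos (Real.exp_pos _), mul_div_assoc, ← Real.exp_sub]
  congr 3
  ring_nf

end Symmetrization

/-! ### Uniform convergence of empirical frequencies -/

/-- The empirical frequency of a set in a sample. -/
def empirical {Ω : Type*} {n : ℕ} (y : Fin n → Ω) (B : Set Ω) : ℝ :=
  (∑ i, B.indicator 1 (y i)) / n

section Deviation

variable {Ω ι : Type*} {n : ℕ}

lemma empirical_nonneg (y : Fin n → Ω) (B : Set Ω) : 0 ≤ empirical y B :=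
  div_nonneg (Finset.sum_nonneg fun _ _ => Set.indicator_nonneg (by simp) _) (Nat.cast_nonneg _)

lemma empirical_le_one (y : Fin n → Ω) (B : Set Ω) : empirical y B ≤ 1 := by
  refine div_le_one_of_le₀ ?_ (Nat.cast_nonneg _)
  refine (Finset.sum_le_card_nsmul _ _ 1 fun i _ => ?_).trans (by simp)
  exact Set.indicator_le_self' (by simp) _

lemma measurable_empirical [MeasurableSpace Ω] {B : Set Ω} (hB : MeasurableSet B) :
    Measurable fun y : Fin n → Ω => empirical y B := by
  have h : Measurable (B.indicator (1 : Ω → ℝ)) := measurable_one.indicator hB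
  unfold empirical
  fun_prop

lemma range_eq_image_traces (B : ι → Set Ω) (c : ℝ) (y y' : Fin n → Ω) :
    (Set.range fun j i => c * (B j).indicator 1 (y i) - c * (B j).indicator 1 (y' i)) =
      (fun (A : Set (Fin n ⊕ Fin n)) i =>
        c * A.indicator 1 (Sum.inl i) - c * A.indicator 1 (Sum.inr i)) ''
          traces (Sum.elim y y') (Set.range B) := by
  classical
  rw [traces, ← Set.range_comp, ← Set.range_comp]
  congr 1

variable [MeasurableSpace Ω] (μ : Measure Ω) [IsProbabilityMeasure μ]

/-- The sign `c = ±1` lets one statement cover both tails. -/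
lemma measure_exists_signed_sum_ge_le [Countable ι] {B : ι → Set Ω}
    (hB : ∀ j, MeasurableSet (B j)) {c : ℝ} (hc : |c| = 1) {t : ℝ} (ht : 0 ≤ t) {N : ℕ}
    (hN : ∀ x : Fin n ⊕ Fin n → Ω, (traces x (Set.range B)).ncard ≤ N) :
    (Measure.pi fun _ : Fin n => μ)
        {y | ∃ j, n * t ≤ ∑ i, (c * (B j).indicator 1 (y i) - c * μ.real (B j))} ≤
      ENNReal.ofReal (N * Real.exp (-(n * t ^ 2 / 2))) := by
  have h := measure_exists_sum_ge_le (n := n) μ (f := fun j x => c * (B j).indicator 1 x)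
    (fun j => (measurable_one.indicator (hB j)).const_mul c) (fun j x => ?_) (fun j x y => ?_)
    ht (N := N) (fun y y' => ?_) (fun y y' => ?_)
  · simpa only [integral_const_mul, integral_indicator_one (hB _)] using h
  · rw [abs_mul, hc, one_mul]
    by_cases hx : x ∈ B j <;> simp [hx]
  · rw [← mul_sub, abs_mul, hc, one_mul]
    by_cases hx : x ∈ B j <;> by_cases hy : y ∈ B j <;> simp [hx, hy]
  · rw [range_eq_image_traces]
    exact (Set.toFinite _).image _
  · rw [range_eq_image_traces]
    exact (Set.ncard_image_le (Set.toFinite _)).trans (hN _)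

/-- The **Vapnik-Chervonenkis inequality**: uniform convergence of empirical frequencies over a
countable family of sets with few traces on double samples. -/
theorem measure_exists_lt_abs_empirical_sub_le [Countable ι] {B : ι → Set Ω}
    (hB : ∀ j, MeasurableSet (B j)) (hn : 0 < n) {t : ℝ} (ht : 0 ≤ t) {N : ℕ}
    (hN : ∀ x : Fin n ⊕ Fin n → Ω, (traces x (Set.range B)).ncard ≤ N) :
    (Measure.pi fun _ : Fin n => μ) {y | ∃ j, t < |empirical y (B j) - μ.real (B j)|} ≤
      ENNReal.ofReal (2 * N * Real.exp (-(n * t ^ 2 / 2))) := by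
  have hn' : (0 : ℝ) < n := Nat.cast_pos.2 hn
  have hsub : {y : Fin n → Ω | ∃ j, t < |empirical y (B j) - μ.real (B j)|} ⊆
      {y | ∃ j, n * t ≤ ∑ i, (1 * (B j).indicator 1 (y i) - 1 * μ.real (B j))} ∪
      {y | ∃ j, n * t ≤ ∑ i, ((-1) * (B j).indicator 1 (y i) - (-1) * μ.real (B j))} := by
    rintro y ⟨j, hj⟩
    have hsum : ∀ c : ℝ, ∑ i, (c * (B j).indicator 1 (y i) - c * μ.real (B j)) =
        n * (c * (empirical y (B j) - μ.real (B j))) := by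
      intro c
      rw [Finset.sum_sub_distrib, ← Finset.mul_sum, Finset.sum_const, Finset.card_univ,
        Fintype.card_fin, nsmul_eq_mul, empirical]
      field_simp
    rcases lt_abs.1 hj with h | h
    · refine Or.inl ⟨j, ?_⟩
      rw [hsum]
      exact mul_le_mul_of_nonneg_left (by linarith) hn'.le
    · refine Or.inr ⟨j, ?_⟩
      rw [hsum]
      exact mul_le_mul_of_nonneg_left (by linarith) hn'.le
  refine (measure_mono hsub).trans ((measure_union_le _ _).trans ?_)
  refine (add_le_add (measure_exists_signed_sum_ge_le μ hB (by simp) ht hN)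
    (measure_exists_signed_sum_ge_le μ hB (by simp) ht hN)).trans ?_
  rw [← ENNReal.ofReal_add (by positivity) (by positivity)]
  refine ENNReal.ofReal_le_ofReal (le_of_eq ?_)
  ring

end Deviation

/-! ### Traces of simplices and of their differences -/

lemma ncard_traces_body_le {I : Type*} [Finite I] (x : I → E K) :
    (traces x (Set.range (body (K := K)))).ncard ≤ ((Nat.card I + 1) ^ (K + 1)) ^ (K + 1) := by
  have hsub : traces x (Set.range (body (K := K))) ⊆
      traces x {A | ∃ B : Fin (K + 1) → Set (E K),
        (∀ i, B i ∈ {B : Set (E K) | Convex ℝ B ∧ Convex ℝ Bᶜ}) ∧ A = ⋂ i, B i} := by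
    refine Set.image_mono ?_
    rintro _ ⟨S, rfl⟩
    refine ⟨_, fun i => ⟨?_, ?_⟩, body_eq_iInter S⟩
    · exact (convex_Ici (0 : ℝ)).affine_preimage ((vertexBasis S).coord i)
    · have h : {x | 0 ≤ (vertexBasis S).coord i x}ᶜ = (vertexBasis S).coord i ⁻¹' Set.Iio 0 := by
        ext x
        simp
      rw [h]
      exact (convex_Iio (0 : ℝ)).affine_preimage ((vertexBasis S).coord i)
  refine (Set.ncard_le_ncard hsub).trans ((ncard_traces_iInter_le x _).trans ?_)
  rw [Fintype.card_fin]
  refine Nat.pow_le_pow_left ?_ _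
  simpa using ncard_traces_halfspace_le x

/-- The sets on which the uniform laws of a family of simplices are compared. -/
def diffSet (T : ℕ → KSimplex K) (p : ℕ × ℕ) : Set (E K) :=
  body (T p.1) \ body (T p.2)

lemma measurableSet_diffSet (T : ℕ → KSimplex K) (p : ℕ × ℕ) : MeasurableSet (diffSet T p) :=
  (measurableSet_body _).diff (measurableSet_body _)

lemma ncard_traces_diffSet_le (T : ℕ → KSimplex K) {n : ℕ} (x : Fin n ⊕ Fin n → E K) :
    (traces x (Set.range (diffSet T))).ncard ≤ (((2 * n + 1) ^ (K + 1)) ^ (K + 1)) ^ 2 := by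
  have hsub : traces x (Set.range (diffSet T)) ⊆
      traces x (Set.image2 (· \ ·) (Set.range (body (K := K))) (Set.range (body (K := K)))) := by
    refine Set.image_mono ?_
    rintro _ ⟨p, rfl⟩
    exact ⟨_, ⟨_, rfl⟩, _, ⟨_, rfl⟩, rfl⟩
  refine (Set.ncard_le_ncard hsub).trans ((ncard_traces_image2_sdiff_le x _).trans ?_)
  refine Nat.pow_le_pow_left ?_ _
  have := ncard_traces_body_le x
  rwa [Nat.card_sum, Nat.card_fin, ← two_mul] at this

/-- The simplex of larger volume must come first in the difference, hence the ordered pairs in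
`diffSet`. -/
lemma exists_diffSet_tv_le (T : ℕ → KSimplex K) (a b : ℕ) :
    ∃ p, tv (unif (T a)) (unif (T b)) ≤
      |(unif (T a)).real (diffSet T p) - (unif (T b)).real (diffSet T p)| := by
  rcases le_total (vol (T b)) (vol (T a)) with h | h
  · exact ⟨(a, b), tv_unif_le_of_vol_le h⟩
  · refine ⟨(b, a), ?_⟩
    rw [tv_comm, abs_sub_comm]
    exact tv_unif_le_of_vol_le h

/-! ### The minimum distance estimator -/

/-- The largest discrepancy between a uniform law and the empirical frequencies. -/
def discrepancy (T : ℕ → KSimplex K) {n : ℕ} (y : Fin n → E K) (j : ℕ) : ℝ :=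
  ⨆ p, |(unif (T j)).real (diffSet T p) - empirical y (diffSet T p)|

section Estimator

variable (T : ℕ → KSimplex K) {n : ℕ} (y : Fin n → E K)

lemma le_discrepancy (j : ℕ) (p : ℕ × ℕ) :
    |(unif (T j)).real (diffSet T p) - empirical y (diffSet T p)| ≤ discrepancy T y j := by
  refine le_ciSup (f := fun p => |(unif (T j)).real (diffSet T p) - empirical y (diffSet T p)|)
    ⟨1, ?_⟩ p
  rintro _ ⟨p, rfl⟩
  exact abs_sub_le_of_nonneg_of_le measureReal_nonneg measureReal_le_one (empirical_nonneg _ _)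
    (empirical_le_one _ _)

lemma discrepancy_nonneg (j : ℕ) : 0 ≤ discrepancy T y j :=
  (abs_nonneg _).trans (le_discrepancy T y j (0, 0))

lemma bddBelow_discrepancy : BddBelow (Set.range (discrepancy T y)) :=
  ⟨0, by rintro _ ⟨j, rfl⟩; exact discrepancy_nonneg T y j⟩

/-- The infimum need not be attained; the slack is positive even for `n = 0` and at most `ε` for the
sample sizes used. -/
lemma exists_discrepancy_le :
    ∃ j, discrepancy T y j ≤ (⨅ i, discrepancy T y i) + 1 / ((n : ℝ) + 1) := by
  obtain ⟨j, hj⟩ := exists_lt_of_ciInf_lt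
    (lt_add_of_pos_right (⨅ i, discrepancy T y i) (Nat.one_div_pos_of_nat (α := ℝ) (n := n)))
  exact ⟨j, hj.le⟩

lemma measurable_discrepancy (j : ℕ) :
    Measurable fun y : Fin n → E K => discrepancy T y j :=
  Measurable.iSup fun p =>
    (measurable_const.sub (measurable_empirical (measurableSet_diffSet T p))).abs

open Classical in
/-- The index of the first simplex which nearly minimizes the discrepancy. -/
def minIndex : ℕ := Nat.find (exists_discrepancy_le T y)

lemma discrepancy_minIndex_le (j : ℕ) :
    discrepancy T y (minIndex T y) ≤ discrepancy T y j + 1 / ((n : ℝ) + 1) := by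
  classical
  refine (Nat.find_spec (exists_discrepancy_le T y)).trans ?_
  gcongr
  exact ciInf_le (bddBelow_discrepancy T y) j

lemma measurable_minIndex : Measurable fun y : Fin n → E K => minIndex T y := by
  classical
  refine measurable_find (exists_discrepancy_le T) fun j => ?_
  exact measurableSet_le (measurable_discrepancy T j)
    ((Measurable.iInf fun i => measurable_discrepancy T i).add_const _)

/-- The minimum distance estimator is close to every simplex whose law is close to the law of the
sample. -/
lemma tv_minIndex_le (μ : Measure (E K)) [IsProbabilityMeasure μ] (S : KSimplex K) {t η : ℝ}
    {j : ℕ} (hj : tv (unif (T j)) (unif S) ≤ η)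
    (ht : ∀ p, |empirical y (diffSet T p) - μ.real (diffSet T p)| ≤ t) :
    tv (unif (T (minIndex T y))) (unif S) ≤
      2 * tv (unif S) μ + 2 * t + 3 * η + 1 / ((n : ℝ) + 1) := by
  have hdisc : discrepancy T y j ≤ η + tv (unif S) μ + t := by
    refine ciSup_le fun p => ?_
    have h1 := (abs_real_sub_real_le_tv (unif (T j)) (unif S) (measurableSet_diffSet T p)).trans hj
    have h2 := abs_real_sub_real_le_tv (unif S) μ (measurableSet_diffSet T p)
    have h3 := ht p
    rw [abs_le] at h1 h2 h3 ⊢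
    constructor <;> linarith
  -- On this set the selected law and that of `T j` differ by at most the sum of their
  -- discrepancies, so by twice that of `T j` plus the slack. Passing from `T j` to `S` costs the
  -- third `η`.
  obtain ⟨p, hp⟩ := exists_diffSet_tv_le T (minIndex T y) j
  have h1 := le_discrepancy T y (minIndex T y) p
  have h2 := le_discrepancy T y j p
  have h3 := discrepancy_minIndex_le T y j
  have h4 := tv_triangle (unif (T (minIndex T y))) (unif (T j)) (unif S)
  have h5 := abs_sub_le ((unif (T (minIndex T y))).real (diffSet T p))
    (empirical y (diffSet T p)) ((unif (T j)).real (diffSet T p))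
  rw [abs_sub_comm (empirical y (diffSet T p))] at h5
  linarith

end Estimator

/-! ### Sample size -/

lemma growth_mul_exp_le {K n : ℕ} (hK : 1 ≤ K) {ε δ : ℝ} (hε : 0 < ε) (hε' : ε < 1 / 7)
    (hδ : 0 < δ) (hδ' : δ < 1)
    (hn : 1000 * (((K : ℝ) ^ 2 * Real.log (1 + K / ε) + Real.log (12 / δ)) / ε ^ 2
      + (K : ℝ) ^ 2 * Real.log (12 / δ)) ≤ n) :
    0 < n ∧ 1 / ((n : ℝ) + 1) ≤ ε ∧
      2 * ((((2 * n + 1) ^ (K + 1)) ^ (K + 1)) ^ 2 : ℕ) * Real.exp (-(n * (2 * ε) ^ 2 / 2)) ≤ δ := by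
  have hK' : (1 : ℝ) ≤ K := by exact_mod_cast hK
  set L := Real.log (1 + K / ε) with hL
  set D := Real.log (12 / δ) with hD
  have hD1 : 1 ≤ D := by
    rw [hD, Real.le_log_iff_exp_le (by positivity), le_div_iff₀ hδ]
    nlinarith [Real.exp_one_lt_d9, Real.exp_pos 1]
  have hKε : 7 ≤ K / ε := by
    rw [le_div_iff₀ hε]
    linarith
  have hL0 : 0 ≤ L := Real.log_nonneg (by linarith)
  have hmain : 1000 * ((K : ℝ) ^ 2 * L + D) ≤ n * ε ^ 2 := by
    have h1 : 1000 * (((K : ℝ) ^ 2 * L + D) / ε ^ 2) ≤ n := by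
      have : 0 ≤ (K : ℝ) ^ 2 * D := by positivity
      linarith
    rwa [← mul_div_assoc, div_le_iff₀ (by positivity)] at h1
  have hKL : 0 ≤ (K : ℝ) ^ 2 * L := by positivity
  have hnε : 1000 ≤ n * ε ^ 2 := by linarith
  have hn0 : 0 < n := by
    rcases Nat.eq_zero_or_pos n with h | h
    · rw [h] at hnε
      norm_num at hnε
    · exact h
  have hn1 : (1 : ℝ) ≤ n := by exact_mod_cast hn0
  refine ⟨hn0, ?_, ?_⟩
  · rw [div_le_iff₀ (by positivity)]
    nlinarith
  -- Linearizing the logarithm at scale `M` turns `8 * K ^ 2 * log (2 * n + 1)` into a small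
  -- multiple of `n * ε ^ 2` plus a multiple of `K ^ 2 * L`.
  · set M : ℝ := 100 * K ^ 2 / ε ^ 2 with hM
    have hM0 : 0 < M := by positivity
    have hlogM : Real.log M ≤ 6 * L := by
      have h1 : M = (10 * (K / ε)) ^ 2 := by rw [hM]; ring
      have h2 : 10 * (K / ε) ≤ (1 + K / ε) ^ 3 := by nlinarith [sq_nonneg (K / ε)]
      have h3 := Real.log_le_log (by positivity) h2
      rw [Real.log_pow] at h3
      rw [h1, Real.log_pow]
      push_cast at h3 ⊢
      linarith
    have hlog : Real.log (2 * n + 1) ≤ (2 * n + 1) / M + Real.log M := by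
      have h1 := Real.log_le_sub_one_of_pos (show 0 < (2 * (n : ℝ) + 1) / M by positivity)
      rw [Real.log_div (by positivity) hM0.ne'] at h1
      linarith
    have hlogn : 8 * (K : ℝ) ^ 2 * Real.log (2 * n + 1) ≤ n * ε ^ 2 / 2 := by
      have h1 : 8 * (K : ℝ) ^ 2 * ((2 * n + 1) / M) = 8 / 100 * ((2 * n + 1) * ε ^ 2) := by
        rw [hM]
        field_simp
      have h2 : 8 * (K : ℝ) ^ 2 * Real.log M ≤ 48 * (K ^ 2 * L) := by
        nlinarith [mul_le_mul_of_nonneg_left hlogM (sq_nonneg (K : ℝ))]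
      have h3 := mul_le_mul_of_nonneg_left hlog (show 0 ≤ 8 * (K : ℝ) ^ 2 by positivity)
      have h4 : (2 * n + 1) * ε ^ 2 ≤ 3 * (n * ε ^ 2) := by nlinarith [sq_nonneg ε]
      rw [mul_add, h1] at h3
      linarith
    have hgrowth : (((((2 * n + 1) ^ (K + 1)) ^ (K + 1)) ^ 2 : ℕ) : ℝ) ≤
        Real.exp (8 * K ^ 2 * Real.log (2 * n + 1)) := by
      -- `2 * (K + 1) ^ 2 ≤ 8 * K ^ 2` because `1 ≤ K`.
      have h1 : ((((2 * n + 1) ^ (K + 1)) ^ (K + 1)) ^ 2 : ℕ) ≤ (2 * n + 1) ^ (8 * K ^ 2) := by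
        rw [← pow_mul, ← pow_mul]
        exact Nat.pow_le_pow_right (Nat.succ_pos _) (by nlinarith)
      calc _ ≤ (((2 * n + 1) ^ (8 * K ^ 2) : ℕ) : ℝ) := by exact_mod_cast h1
        _ = _ := by
          rw [mul_comm (8 * (K : ℝ) ^ 2), ← Real.rpow_def_of_pos (by positivity)]
          exact_mod_cast (Real.rpow_natCast (2 * (n : ℝ) + 1) (8 * K ^ 2)).symm
    have h12 : δ = 12 * Real.exp (-D) := by
      rw [hD, Real.exp_neg, Real.exp_log (by positivity)]
      field_simp
    calc _ ≤ 2 * Real.exp (8 * K ^ 2 * Real.log (2 * n + 1)) *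
          Real.exp (-(n * (2 * ε) ^ 2 / 2)) := by gcongr
      _ = 2 * Real.exp (8 * K ^ 2 * Real.log (2 * n + 1) + -(n * (2 * ε) ^ 2 / 2)) := by
        rw [mul_assoc, Real.exp_add]
      _ ≤ 2 * Real.exp (-D) := by
        gcongr
        linarith
      _ ≤ δ := by
        rw [h12]
        linarith [Real.exp_pos (-D)]

end SimplexLearning

end


/-! ### The learning theorem -/

theorem theorem3 (θlo θhi : ℝ) (hlo : 0 < θlo) (hhi : 0 < θhi) :
    ∃ C : ℝ, 0 < C ∧ ∀ K : ℕ, 1 ≤ K →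
      -- the learning algorithm: a measurable map from finite samples to simplices
      ∃ A : (n : ℕ) → (Fin n → SimplexLearning.E K) → SimplexLearning.KSimplex K,
        (∀ n : ℕ, Measurable fun y : Fin n → SimplexLearning.E K => (A n y).points) ∧
        ∀ ε δ : ℝ, 0 < ε → 0 < δ → ∀ n : ℕ,
          C * (((K : ℝ) ^ 2 * Real.log (1 + (K : ℝ) / ε) + Real.log (12 / δ)) / ε ^ 2
              + (K : ℝ) ^ 2 * Real.log (12 / δ)) ≤ (n : ℝ) →
          ∀ S : SimplexLearning.KSimplex K, SimplexLearning.IsIsoperimetric θlo θhi S →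
          ∀ σ : ℝ, 0 < σ →
            (MeasureTheory.Measure.pi fun _ : Fin n => SimplexLearning.noisy S σ)
                {y | 4 * SimplexLearning.tv (SimplexLearning.unif S) (SimplexLearning.noisy S σ)
                    + 7 * ε
                  < SimplexLearning.tv (SimplexLearning.unif (A n y)) (SimplexLearning.unif S)}
              ≤ ENNReal.ofReal δ := by
  refine ⟨1000, by norm_num, fun K hK => ?_⟩
  obtain ⟨T, hT⟩ := SimplexLearning.exists_tv_dense_seq K
  refine ⟨fun n y => T (SimplexLearning.minIndex T y), fun n => ?_, ?_⟩
  · exact (measurable_from_nat (f := fun j => (T j).points)).comp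
      (SimplexLearning.measurable_minIndex T)
  intro ε δ hε hδ n hn S _ σ _
  have h0 := SimplexLearning.tv_nonneg (SimplexLearning.unif S) (SimplexLearning.noisy S σ)
  rcases le_or_gt 1 δ with hδ' | hδ'
  · exact prob_le_one.trans (ENNReal.one_le_ofReal.2 hδ')
  -- If `7 * ε ≥ 1` the bad event is empty, since `tv ≤ 1`.
  rcases le_or_gt (1 / 7) ε with hε' | hε'
  · refine (measure_mono_null (t := ∅) ?_ measure_empty).trans_le zero_le
    refine Set.subset_empty_iff.2 <| Set.eq_empty_iff_forall_notMem.2 fun y hy => ?_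
    have := SimplexLearning.tv_le_one (SimplexLearning.unif (T (SimplexLearning.minIndex T y)))
      (SimplexLearning.unif S)
    simp only [Set.mem_ofPred_eq] at hy
    linarith
  obtain ⟨hn0, hn1, hbound⟩ := SimplexLearning.growth_mul_exp_le hK hε hε' hδ hδ' hn
  -- With `η = ε / 3`, `t = 2 * ε` and slack at most `ε`, the error is at most `2 * tv + 6 * ε`.
  obtain ⟨j, hj⟩ := hT S (ε / 3) (by positivity)
  have hdev := SimplexLearning.measure_exists_lt_abs_empirical_sub_le
    (SimplexLearning.noisy S σ) (SimplexLearning.measurableSet_diffSet T) hn0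
    (show 0 ≤ 2 * ε by positivity) (SimplexLearning.ncard_traces_diffSet_le T)
  refine (measure_mono fun y hy => ?_).trans (hdev.trans (ENNReal.ofReal_le_ofReal hbound))
  by_contra hcon
  simp only [Set.mem_ofPred_eq, not_exists, not_lt] at hy hcon
  have := SimplexLearning.tv_minIndex_le T y (SimplexLearning.noisy S σ) S hj hcon
  linarith
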